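/- Let $n\ge 1$, $d\ge 2$, and let $|\psi\rangle_{A_1\cdots A_n}=\sqrt p\,|W_n^d\rangle+\sqrt{1-p}\,|0\cdots 0\rangle$ with $0\le p\le 1$ be an $n$-qudit GWV state, where $|W_n^d\rangle=\sum_{i=1}^{d-1}\big(a_{1i}|i0\cdots 0\rangle+a_{2i}|0i0\cdots 0\rangle+\cdots+a_{ni}|0\cdots 0i\rangle\big)$ with complex coefficients satisfying $\sum_{s=1}^n\sum_{i=1}^{d-1}|a_{si}|^2=1$. For a bipartite pure state $|\varphi\rangle_{AB}$ with reduced state $\rho_A=\mathrm{tr}_B|\varphi\rangle\langle\varphi|$ put $T_q(|\varphi\rangle)=\frac{1-\mathrm{tr}\,\rho_A^q}{q-1}$ for $q>0$, $q\ne 1$, and let $T_1(|\varphi\rangle)=-\mathrm{tr}(\rho_A\ln\rho_A)$ be its limit as $q\to 1$. For a bipartite density matrix $\rho_{AB}$ let $T_q(\rho_{A|B})=\inf\sum_i p_iT_q(|\varphi_i\rangle)$, the infimum being over all finite pure state decompositions $\rho_{AB}=\sum_i p_i|\varphi_i\rangle\langle\varphi_i|$. Let $P,P_0,\dots,P_{r-1}$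 be nonempty, pairwise disjoint sets of parties, i.e. a partition of a subset of $\{A_1,\dots,A_n\}$. Write $T_q(\rho_{PP_j})$ for the Tsallis-$q$ entanglement, with respect to the bipartition $P|P_j$, of the reduced density matrix of $|\psi\rangle$ on $P\cup P_j$, and $T_q(\rho_{P|P_0\cdots P_{r-1}})$ for that of the reduced density matrix on $P\cup P_0\cup\cdots\cup P_{r-1}$ with respect to the bipartition $P\,|\,P_0\cup\cdots\cup P_{r-1}$. Let $q\in\big[\frac{5-\sqrt{13}}2,\frac{5+\sqrt{13}}2\big]$, $0<k\le 1$ and $\beta\ge 2$. If $k\,T_q^2(\rho_{PP_j})\ge T_q^2(\rho_{PP_{j+1}})$ for $j=0,\dots,r-2$, then $$T_q^\beta(\rho_{P|P_0\cdots P_{r-1}})\ \ge\ \sum_{j=0}^{r-1}(\mathcal K_\beta)^{\omega_H(j)}\,T_q^\beta(\rho_{PP_j}),\qquad \mathcal K_\beta=\frac{(1+k)^{\beta/2}-1}{k^{\beta/2}},$$ where $\omega_H(j)$ is the Hamming weight of $j$, i.e. the number of ones in the binary expansion of $j$. -/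

import Mathlib

noncomputable section

namespace GWV

open scoped BigOperators

/-! ### Bipartite states and the Tsallis-`q` entanglement -/

/-- A (normalised) pure state vector with coordinates in the computational basis `κ`. -/
def IsUnitVec {κ : Type*} [Fintype κ] (ψ : κ → ℂ) : Prop :=
  ∑ x, ‖ψ x‖ ^ 2 = 1

/-- The rank-one operator `|ψ⟩⟨ψ|`. -/
def proj {κ : Type*} (ψ : κ → ℂ) : Matrix κ κ ℂ :=
  Matrix.vecMulVec ψ (star ψ)

/-- The reduced operator `ρ_A = tr_B |ψ⟩⟨ψ|` of a bipartite vector `ψ`. -/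
def marginal {α β : Type*} [Fintype β] (ψ : α × β → ℂ) : Matrix α α ℂ :=
  Matrix.of fun i j => ∑ b, proj ψ (i, b) (j, b)

theorem marginal_isHermitian {α β : Type*} [Fintype β] (ψ : α × β → ℂ) :
    (marginal ψ).IsHermitian := by
  ext i j
  simp [marginal, proj, Matrix.vecMulVec_apply, Matrix.conjTranspose_apply, mul_comm]

/-- The Tsallis-`q` entropy `(1 - tr ρ ^ q) / (q - 1)`, computed from the eigenvalues of `ρ`;
at `q = 1` it is its limit, the von Neumann entropy `- tr (ρ log ρ)`. -/
def tsallisEntropy {α : Type*} [Fintype α] [DecidableEq α] (q : ℝ) {ρ : Matrix α α ℂ}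
    (hρ : ρ.IsHermitian) : ℝ :=
  if q = 1 then ∑ i, Real.negMulLog (hρ.eigenvalues i)
  else (1 - ∑ i, hρ.eigenvalues i ^ q) / (q - 1)

/-- The Tsallis-`q` entanglement of a bipartite pure state. -/
def pureT {α β : Type*} [Fintype α] [DecidableEq α] [Fintype β] (q : ℝ) (ψ : α × β → ℂ) : ℝ :=
  tsallisEntropy q (marginal_isHermitian ψ)

/-- `(w, φ)` is a pure state decomposition `ρ = ∑ i, w i |φ i⟩⟨φ i|`. -/
structure IsPureDecomposition {κ : Type*} [Fintype κ] (ρ : Matrix κ κ ℂ) {N : ℕ}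
    (w : Fin N → ℝ) (φ : Fin N → κ → ℂ) : Prop where
  nonneg : ∀ i, 0 ≤ w i
  sum_eq_one : ∑ i, w i = 1
  unit : ∀ i, IsUnitVec (φ i)
  eq_sum : ρ = ∑ i, (w i : ℂ) • proj (φ i)

/-- The Tsallis-`q` entanglement of a bipartite density matrix: the minimal average entanglement
over all pure state decompositions. -/
def mixedT {α β : Type*} [Fintype α] [DecidableEq α] [Fintype β] (q : ℝ)
    (ρ : Matrix (α × β) (α × β) ℂ) : ℝ :=
  sInf {t : ℝ | ∃ (N : ℕ) (w : Fin N → ℝ) (φ : Fin N → α × β → ℂ),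
    IsPureDecomposition ρ w φ ∧ t = ∑ i, w i * pureT q (φ i)}

/-! ### Multi-qudit states -/

/-- The basis configuration of `n` qudits that is `a` on the parties in `P`, `b` on the parties
in `Q` and `e` on all other parties (`P` and `Q` are meant to be disjoint). -/
def glue {n d : ℕ} (P Q : Finset (Fin n)) (a : P → Fin d) (b : Q → Fin d)
    (e : {s : Fin n // s ∉ P ∪ Q} → Fin d) : Fin n → Fin d := fun s =>
  if hP : s ∈ P then a ⟨s, hP⟩
  else if hQ : s ∈ Q then b ⟨s, hQ⟩
  else e ⟨s, by simp [hP, hQ]⟩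

/-- The reduced density matrix of an `n`-qudit operator `ρ` on the parties in `P ∪ Q`, viewed as a
bipartite operator with respect to `P | Q`: all other parties are traced out. -/
def reduced {n d : ℕ} (ρ : Matrix (Fin n → Fin d) (Fin n → Fin d) ℂ) (P Q : Finset (Fin n)) :
    Matrix ((P → Fin d) × (Q → Fin d)) ((P → Fin d) × (Q → Fin d)) ℂ :=
  Matrix.of fun x y => ∑ e : {s : Fin n // s ∉ P ∪ Q} → Fin d,
    ρ (glue P Q x.1 x.2 e) (glue P Q y.1 y.2 e)

/-- `T_q(ρ_{P|Q})` for the `n`-qudit pure state `ψ`. -/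
def T {n d : ℕ} (q : ℝ) (ψ : (Fin n → Fin d) → ℂ) (P Q : Finset (Fin n)) : ℝ :=
  mixedT q (reduced (proj ψ) P Q)

/-- The computational basis vector `|x⟩`. -/
def ket {n d : ℕ} (x : Fin n → Fin d) : (Fin n → Fin d) → ℂ :=
  Pi.single x 1

/-- The generalized `W`-class vector `∑ s, ∑ i ≠ 0, a s i |0 ⋯ 0 i 0 ⋯ 0⟩`, with `i` at
position `s`. -/
def wVec {n d : ℕ} [NeZero d] (a : Fin n → Fin d → ℂ) : (Fin n → Fin d) → ℂ :=
  ∑ s : Fin n, ∑ i ∈ Finset.univ.filter (fun i : Fin d => i ≠ 0), a s i • ket (Pi.single s i)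

/-- `ψ` is a superposition `√p |W⟩ + √(1 - p) |0 ⋯ 0⟩` of a normalised generalized `W`-class state
and the vacuum. -/
def IsGWV {n d : ℕ} [NeZero d] (ψ : (Fin n → Fin d) → ℂ) : Prop :=
  ∃ (a : Fin n → Fin d → ℂ) (p : ℝ), 0 ≤ p ∧ p ≤ 1 ∧
    ∑ s : Fin n, ∑ i ∈ Finset.univ.filter (fun i : Fin d => i ≠ 0), ‖a s i‖ ^ 2 = 1 ∧
    ψ = (Real.sqrt p : ℂ) • wVec a + (Real.sqrt (1 - p) : ℂ) • ket 0

/-! ### The coefficients -/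

/-- The Hamming weight of the binary expansion of `j`: its number of ones. -/
def hammingWeight (j : ℕ) : ℕ := (Nat.digits 2 j).count 1

/-- `K_β = ((1 + k) ^ (β / 2) - 1) / k ^ (β / 2)`. -/
def K (k β : ℝ) : ℝ := ((1 + k) ^ (β / 2) - 1) / k ^ (β / 2)

end GWV

end

/-!
A GWV state has at most one excited party, so tracing out all parties except `P ∪ Q` leaves
`|φ⟩⟨φ| + Z |00⟩⟨00|` with `φ` a combination of `|0⟩|0⟩`, a vector `|x⟩|0⟩` and a vector `|0⟩|y⟩`
(`SingleExcitation.reduced_eq`). Such a state is effectively one of two qubits. Every member of a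
pure state decomposition lies in the span of `φ` and `|00⟩`; therefore all decompositions have the
same average concurrence `2 ‖x‖ ‖y‖` (`IsPureDecomposition.cross`). The entanglement of a member is
a function `concurrenceT q` of its concurrence `C`, namely the entropy of a qubit with eigenvalues
`(1 ± √(1 - C ^ 2)) / 2` (`pureT_of_cross`). In the given range of `q` this function is convex
(`convexOn_concurrenceT`), so the entanglement of the mixed state is its value at `2 ‖x‖ ‖y‖`,
attained by an explicit decomposition into two vectors of equal concurrence (`mixedT_cross`).

Now `‖x‖ ^ 2` and `‖y‖ ^ 2` are the probabilities that a party of `P`, respectively `Q`, is excited.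
Hence the squared concurrence is additive in `Q`. A convex function vanishing at `0` has a
nondecreasing ratio `concurrenceT q C / C`, and this turns the additivity into the monogamy
inequality `∑ j, T(P|Q j) ^ 2 ≤ T(P|⋃ j, Q j) ^ 2` (`sum_concurrenceT_sq_le`). It remains to raise
to the power `β / 2` and to expand the power of the sum by merging neighbouring terms repeatedly
(`sum_K_pow_hammingWeight_mul_rpow_le`).

For the convexity with `q = m + 1 ≠ 1`, the second derivative in `C` is nonnegative iff
`s * ((1 - s) * (1 + s) ^ m + (1 + s) * (1 - s) ^ m)` is at most `((1 + s) ^ m - (1 - s) ^ m) / m`,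
where `s = √(1 - C ^ 2)`. After collecting the two powers and taking logarithms, both sides agree at
`s = 0` and the derivative of their difference is a rational function of visible sign
(`log_convexity_condition`); `m ^ 2 - 3 * m - 1 ≤ 0`, the given range of `q`, is what its sign at
small `s` requires. The case `q = 1` is a limit.
-/

namespace GWV

open Filter Topology

/-! ### The Tsallis entropy of a qubit as a function of the concurrence -/

/-- The summand of the Tsallis-`q` entropy: a spectrum `l` with `∑ i, l i = 1` has entropy
`∑ i, entropySummand q (l i)`. The term `x` in `x - x ^ q` distributes the constant `1` of
`1 - tr ρ ^ q` over the eigenvalues, so that zero eigenvalues contribute nothing. -/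
noncomputable def entropySummand (q x : ℝ) : ℝ :=
  if q = 1 then Real.negMulLog x else (x - x ^ q) / (q - 1)

/-- The Tsallis-`q` entropy of a qubit with eigenvalues `(1 ± √(1 - C ^ 2)) / 2`. It is the
Tsallis-`q` entanglement of a two-qubit pure state of concurrence `C`. -/
noncomputable def concurrenceT (q C : ℝ) : ℝ :=
  entropySummand q ((1 + √(1 - C ^ 2)) / 2) + entropySummand q ((1 - √(1 - C ^ 2)) / 2)

theorem entropySummand_zero {q : ℝ} (hq : q ≠ 0) : entropySummand q 0 = 0 := by
  simp [entropySummand, Real.zero_rpow hq]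

theorem entropySummand_one (q : ℝ) : entropySummand q 1 = 0 := by
  simp [entropySummand]

theorem entropySummand_nonneg {q x : ℝ} (hq : 0 < q) (h0 : 0 ≤ x) (h1 : x ≤ 1) :
    0 ≤ entropySummand q x := by
  unfold entropySummand
  split_ifs with h
  · exact Real.negMulLog_nonneg h0 h1
  · rcases h0.eq_or_lt with rfl | h0
    · simp [Real.zero_rpow hq.ne']
    rcases lt_or_gt_of_ne h with h | h
    · refine div_nonneg_of_nonpos ?_ (by linarith)
      have := Real.rpow_le_rpow_of_exponent_ge h0 h1 h.le
      rw [Real.rpow_one] at this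
      linarith
    · refine div_nonneg ?_ (by linarith)
      have := Real.rpow_le_rpow_of_exponent_ge h0 h1 h.le
      rw [Real.rpow_one] at this
      linarith

theorem concurrenceT_zero {q : ℝ} (hq : q ≠ 0) : concurrenceT q 0 = 0 := by
  simp [concurrenceT, entropySummand_zero hq, entropySummand_one]

theorem concurrenceT_nonneg {q : ℝ} (hq : 0 < q) (C : ℝ) : 0 ≤ concurrenceT q C := by
  have h0 := Real.sqrt_nonneg (1 - C ^ 2)
  have h1 : √(1 - C ^ 2) ≤ 1 := Real.sqrt_le_one.mpr (by nlinarith [sq_nonneg C])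
  exact add_nonneg (entropySummand_nonneg hq (by linarith) (by linarith))
    (entropySummand_nonneg hq (by linarith) (by linarith))

theorem exponent_bounds {m : ℝ} (hm : m ^ 2 - 3 * m - 1 ≤ 0) : -(1 / 3) < m ∧ m < 4 := by
  constructor <;> by_contra! h <;> nlinarith

theorem one_add_quadratic_pos {m s : ℝ} (hm : m ^ 2 - 3 * m - 1 ≤ 0) (h0 : 0 ≤ s) (h1 : s < 1) :
    0 < 1 + m * s * (1 + s) := by
  obtain ⟨h2, -⟩ := exponent_bounds hm
  nlinarith [mul_nonneg (by linarith : 0 ≤ m + 1 / 3) (by positivity : 0 ≤ s * (1 + s))]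

theorem one_sub_quadratic_pos {m s : ℝ} (hm : m ^ 2 - 3 * m - 1 ≤ 0) (h0 : 0 ≤ s) (h1 : s < 1) :
    0 < 1 - m * s * (1 - s) := by
  obtain ⟨-, h2⟩ := exponent_bounds hm
  nlinarith [mul_nonneg (by linarith : 0 ≤ 4 - m) (mul_nonneg h0 (by linarith : 0 ≤ 1 - s)),
    sq_nonneg (1 - 2 * s), mul_nonneg h0 (by linarith : 0 ≤ 1 - s)]

/-- The logarithmic form of the convexity condition. The derivative in `s` is
`2 * s ^ 2 * ((1 + 3 * m - m ^ 2) + (m ^ 2 - m) * s ^ 2)` over a positive denominator, and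
`m ^ 2 - 3 * m - 1 ≤ 0` is what makes it nonnegative near `s = 0`. -/
theorem log_convexity_condition {m s : ℝ} (hm0 : m ≠ 0) (hm : m ^ 2 - 3 * m - 1 ≤ 0)
    (h0 : 0 ≤ s) (h1 : s < 1) :
    0 ≤ (m * Real.log (1 + s) - m * Real.log (1 - s) - Real.log (1 + m * s * (1 + s))
      + Real.log (1 - m * s * (1 - s))) / m := by
  set L : ℝ → ℝ := fun s => (m * Real.log (1 + s) - m * Real.log (1 - s)
    - Real.log (1 + m * s * (1 + s)) + Real.log (1 - m * s * (1 - s))) / m with hL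
  have hder : ∀ x ∈ Set.Ico (0 : ℝ) 1, HasDerivAt L
      ((m * (1 / (1 + x)) - m * ((-1) / (1 - x)) - (m + 2 * m * x) / (1 + m * x * (1 + x))
        + (-m + 2 * m * x) / (1 - m * x * (1 - x))) / m) x := by
    intro x hx
    have hp := one_add_quadratic_pos hm hx.1 hx.2
    have hn := one_sub_quadratic_pos hm hx.1 hx.2
    have e1 : HasDerivAt (fun s : ℝ => 1 + s) 1 x := (hasDerivAt_id x).const_add 1
    have e2 : HasDerivAt (fun s : ℝ => 1 - s) (-1) x := (hasDerivAt_id x).const_sub 1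
    have e3 : HasDerivAt (fun s : ℝ => m * s) m x := by
      simpa using (hasDerivAt_id x).const_mul m
    have e4 : HasDerivAt (fun s : ℝ => 1 + m * s * (1 + s)) (m + 2 * m * x) x :=
      ((e3.mul e1).const_add 1).congr_deriv (by ring)
    have e5 : HasDerivAt (fun s : ℝ => 1 - m * s * (1 - s)) (-m + 2 * m * x) x :=
      ((e3.mul e2).const_sub 1).congr_deriv (by ring)
    exact (((((e1.log (by linarith [hx.1])).const_mul m).sub
      ((e2.log (by linarith [hx.2])).const_mul m)).sub (e4.log hp.ne')).add
      (e5.log hn.ne')).div_const m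
  have hmono : MonotoneOn L (Set.Ico 0 1) := by
    refine monotoneOn_of_hasDerivWithinAt_nonneg (convex_Ico 0 1)
      (fun x hx => (hder x hx).continuousAt.continuousWithinAt)
      (fun x hx => (hder x (interior_subset hx)).hasDerivWithinAt) (fun x hx => ?_)
    have hx := interior_subset hx
    have hp := one_add_quadratic_pos hm hx.1 hx.2
    have hn := one_sub_quadratic_pos hm hx.1 hx.2
    have h1 : 0 < 1 + x := by linarith [hx.1]
    have h2 : 0 < 1 - x := by linarith [hx.2]
    have key : (m * (1 / (1 + x)) - m * ((-1) / (1 - x)) - (m + 2 * m * x) / (1 + m * x * (1 + x))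
        + (-m + 2 * m * x) / (1 - m * x * (1 - x))) / m
        = 2 * x ^ 2 * ((1 + 3 * m - m ^ 2) * (1 - x ^ 2) + (1 + 2 * m) * x ^ 2)
          / ((1 + x) * (1 - x) * (1 + m * x * (1 + x)) * (1 - m * x * (1 - x))) := by
      field_simp
      ring
    rw [key]
    have := (exponent_bounds hm).1
    have h3 : 0 ≤ 1 - x ^ 2 := by nlinarith [hx.1]
    have h4 : 0 ≤ (1 + 3 * m - m ^ 2) * (1 - x ^ 2) := mul_nonneg (by linarith) h3
    have h5 : 0 ≤ (1 + 2 * m) * x ^ 2 := mul_nonneg (by linarith) (sq_nonneg x)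
    positivity
  have := hmono (Set.left_mem_Ico.mpr one_pos) ⟨h0, h1⟩ h0
  simpa [hL] using this

/-- Nonnegativity of the second derivative of `concurrenceT q`, up to positive factors, for
`m = q - 1` and `s = √(1 - C ^ 2)`. -/
theorem convexity_condition {m s : ℝ} (hm0 : m ≠ 0) (hm : m ^ 2 - 3 * m - 1 ≤ 0)
    (h0 : 0 ≤ s) (h1 : s < 1) :
    0 ≤ ((1 + s) ^ m * (1 - m * s * (1 - s)) - (1 - s) ^ m * (1 + m * s * (1 + s))) / m := by
  have hL := log_convexity_condition hm0 hm h0 h1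
  have hp := one_add_quadratic_pos hm h0 h1
  have hn := one_sub_quadratic_pos hm h0 h1
  have ha : 0 < 1 + s := by linarith
  have hb : 0 < 1 - s := by linarith
  have ha' := Real.rpow_pos_of_pos ha m
  have hb' := Real.rpow_pos_of_pos hb m
  have la : Real.log ((1 + s) ^ m * (1 - m * s * (1 - s)))
      = m * Real.log (1 + s) + Real.log (1 - m * s * (1 - s)) := by
    rw [Real.log_mul ha'.ne' hn.ne', Real.log_rpow ha]
  have lb : Real.log ((1 - s) ^ m * (1 + m * s * (1 + s)))
      = m * Real.log (1 - s) + Real.log (1 + m * s * (1 + s)) := by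
    rw [Real.log_mul hb'.ne' hp.ne', Real.log_rpow hb]
  rcases lt_or_gt_of_ne hm0 with hneg | hpos
  · refine div_nonneg_of_nonpos (sub_nonpos.mpr ?_) hneg.le
    rw [← Real.log_le_log_iff (by positivity) (by positivity), la, lb]
    have := mul_nonpos_of_nonpos_of_nonneg hneg.le hL
    rw [mul_div_cancel₀ _ hm0] at this
    linarith
  · refine div_nonneg (sub_nonneg.mpr ?_) hpos.le
    rw [← Real.log_le_log_iff (by positivity) (by positivity), la, lb]
    have := mul_nonneg hpos.le hL
    rw [mul_div_cancel₀ _ hm0] at this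
    linarith

theorem concurrenceT_of_ne_one {q : ℝ} (hq : q ≠ 1) (C : ℝ) :
    concurrenceT q C
      = (1 - (((1 + √(1 - C ^ 2)) / 2) ^ q + ((1 - √(1 - C ^ 2)) / 2) ^ q)) / (q - 1) := by
  simp only [concurrenceT, entropySummand, if_neg hq]
  ring

theorem convexOn_concurrenceT_of_ne_one {q : ℝ} (hq0 : 0 < q) (hq1 : q ≠ 1)
    (hq : (q - 1) ^ 2 - 3 * (q - 1) - 1 ≤ 0) :
    ConvexOn ℝ (Set.Icc 0 1) (concurrenceT q) := by
  obtain ⟨m, rfl⟩ : ∃ m, q = m + 1 := ⟨q - 1, by ring⟩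
  rw [add_sub_cancel_right] at hq
  have hm0 : m ≠ 0 := fun h => hq1 (by simp [h])
  have hfun : concurrenceT (m + 1) = fun C => (1 - (((1 + √(1 - C ^ 2)) / 2) ^ (m + 1)
      + ((1 - √(1 - C ^ 2)) / 2) ^ (m + 1))) / m := by
    funext C
    rw [concurrenceT_of_ne_one hq1, add_sub_cancel_right]
  have hs : ∀ x ∈ Set.Ioo (0 : ℝ) 1, 0 < √(1 - x ^ 2) ∧ √(1 - x ^ 2) < 1 := fun x hx =>
    ⟨Real.sqrt_pos.mpr (by nlinarith [hx.1, hx.2]),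
      (Real.sqrt_lt' one_pos).mpr (by nlinarith [hx.1, hx.2])⟩
  have hsd : ∀ x ∈ Set.Ioo (0 : ℝ) 1,
      HasDerivAt (fun C : ℝ => √(1 - C ^ 2)) (-(x / √(1 - x ^ 2))) x := fun x hx => by
    have h1 := (hs x hx).1
    have : HasDerivAt (fun C : ℝ => 1 - C ^ 2) (-(2 * x)) x := by
      simpa using (hasDerivAt_pow 2 x).const_sub 1
    refine (this.sqrt (Real.sqrt_pos.mp h1).ne').congr_deriv ?_
    field_simp
  refine convexOn_of_hasDerivWithinAt2_nonneg (convex_Icc 0 1)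
    (f' := fun C => (m + 1) / (2 * m) * (C / √(1 - C ^ 2)
      * (((1 + √(1 - C ^ 2)) / 2) ^ m - ((1 - √(1 - C ^ 2)) / 2) ^ m)))
    (f'' := fun C => (m + 1) / (2 * m) * (1 / √(1 - C ^ 2) ^ 3
      * (((1 + √(1 - C ^ 2)) / 2) ^ m - ((1 - √(1 - C ^ 2)) / 2) ^ m)
      - C ^ 2 / √(1 - C ^ 2) ^ 2 * (m / 2) * (((1 + √(1 - C ^ 2)) / 2) ^ (m - 1)
        + ((1 - √(1 - C ^ 2)) / 2) ^ (m - 1)))) ?_ ?_ ?_ ?_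
  · rw [hfun]
    refine Continuous.continuousOn ?_
    have h1 : Continuous fun C : ℝ => ((1 + √(1 - C ^ 2)) / 2) ^ (m + 1) :=
      Continuous.rpow_const (by fun_prop) fun _ => Or.inr hq0.le
    have h2 : Continuous fun C : ℝ => ((1 - √(1 - C ^ 2)) / 2) ^ (m + 1) :=
      Continuous.rpow_const (by fun_prop) fun _ => Or.inr hq0.le
    fun_prop
  · rw [interior_Icc]
    intro x hx
    obtain ⟨h1, h2⟩ := hs x hx
    have d := hsd x hx
    have da := ((d.const_add 1).div_const 2).rpow_const (p := m + 1) (Or.inl (by positivity))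
    have db := ((d.const_sub 1).div_const 2).rpow_const (p := m + 1)
      (Or.inl (by linarith : 0 < (1 - √(1 - x ^ 2)) / 2).ne')
    rw [hfun]
    refine (((da.add db).const_sub 1).div_const m).hasDerivWithinAt.congr_deriv ?_
    rw [add_sub_cancel_right]
    field_simp
    ring
  · rw [interior_Icc]
    intro x hx
    obtain ⟨h1, h2⟩ := hs x hx
    have d := hsd x hx
    have hsq : √(1 - x ^ 2) ^ 2 = 1 - x ^ 2 := Real.sq_sqrt (Real.sqrt_pos.mp h1).le
    have da := ((d.const_add 1).div_const 2).rpow_const (p := m) (Or.inl (by positivity))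
    have db := ((d.const_sub 1).div_const 2).rpow_const (p := m)
      (Or.inl (by linarith : 0 < (1 - √(1 - x ^ 2)) / 2).ne')
    have du : HasDerivAt (fun C : ℝ => C / √(1 - C ^ 2)) (1 / √(1 - x ^ 2) ^ 3) x := by
      refine ((hasDerivAt_id x).div d h1.ne').congr_deriv ?_
      simp only [id]
      field_simp
      rw [hsq]
      ring
    refine ((du.mul (da.sub db)).const_mul ((m + 1) / (2 * m))).hasDerivWithinAt.congr_deriv ?_
    simp only [Pi.sub_apply]
    field_simp
    ring
  · rw [interior_Icc]
    intro x hx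
    obtain ⟨h1, h2⟩ := hs x hx
    have hsq : √(1 - x ^ 2) ^ 2 = 1 - x ^ 2 := Real.sq_sqrt (Real.sqrt_pos.mp h1).le
    have hc := convexity_condition hm0 hq h1.le h2
    set s := √(1 - x ^ 2)
    have hx2 : x ^ 2 = (1 + s) * (1 - s) := by linarith
    have ha : 0 < (1 + s) / 2 := by linarith
    have hb : 0 < (1 - s) / 2 := by linarith
    have key : (m + 1) / (2 * m) * (1 / s ^ 3 * (((1 + s) / 2) ^ m - ((1 - s) / 2) ^ m)
        - x ^ 2 / s ^ 2 * (m / 2) * (((1 + s) / 2) ^ (m - 1) + ((1 - s) / 2) ^ (m - 1)))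
        = (m + 1) / (2 * 2 ^ m * s ^ 3) * (((1 + s) ^ m * (1 - m * s * (1 - s))
          - (1 - s) ^ m * (1 + m * s * (1 + s))) / m) := by
      rw [Real.rpow_sub_one ha.ne', Real.rpow_sub_one hb.ne', hx2,
        Real.div_rpow (by linarith) two_pos.le, Real.div_rpow (by linarith) two_pos.le]
      have h3 : (1 - s) ≠ 0 := by linarith
      have h4 : (1 + s) ≠ 0 := by linarith
      have h5 : (2 : ℝ) ^ m ≠ 0 := (Real.rpow_pos_of_pos two_pos m).ne'
      field_simp
      ring
    rw [key]
    exact mul_nonneg (by positivity) hc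

theorem tendsto_entropySummand_one {x : ℝ} (hx : 0 ≤ x) :
    Tendsto (fun q => entropySummand q x) (𝓝[≠] 1) (𝓝 (entropySummand 1 x)) := by
  have hne : ∀ᶠ q : ℝ in 𝓝[≠] 1, q ≠ 1 := eventually_mem_nhdsWithin
  rcases hx.eq_or_lt with rfl | hx
  · rw [entropySummand_zero one_ne_zero]
    refine tendsto_const_nhds.congr' ?_
    have : ∀ᶠ q : ℝ in 𝓝[≠] 1, q ≠ 0 :=
      (eventually_ne_nhds one_ne_zero).filter_mono nhdsWithin_le_nhds
    filter_upwards [this] with q hq using (entropySummand_zero hq).symm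
  · have hd : HasDerivAt (fun q : ℝ => x ^ q) (x * Real.log x) 1 := by
      simpa using (Real.hasStrictDerivAt_const_rpow hx 1).hasDerivAt
    have := (hasDerivAt_iff_tendsto_slope.mp hd).neg
    have e : entropySummand 1 x = -(x * Real.log x) := by
      simp [entropySummand, Real.negMulLog]
    rw [e]
    refine this.congr' ?_
    filter_upwards [hne] with q hq
    rw [slope_def_field, entropySummand, if_neg hq, Real.rpow_one, ← neg_div, neg_sub]

theorem tendsto_concurrenceT_one (C : ℝ) :
    Tendsto (fun q => concurrenceT q C) (𝓝[≠] 1) (𝓝 (concurrenceT 1 C)) := by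
  have h0 := Real.sqrt_nonneg (1 - C ^ 2)
  have h1 : √(1 - C ^ 2) ≤ 1 := Real.sqrt_le_one.mpr (by nlinarith [sq_nonneg C])
  exact (tendsto_entropySummand_one (by linarith)).add (tendsto_entropySummand_one (by linarith))

/-- The entropy as a function of the concurrence is convex: the endpoints for `q` are the roots
of `(q - 1) ^ 2 - 3 * (q - 1) - 1`. -/
theorem convexOn_concurrenceT {q : ℝ}
    (hq : q ∈ Set.Icc ((5 - √13) / 2) ((5 + √13) / 2)) :
    ConvexOn ℝ (Set.Icc 0 1) (concurrenceT q) := by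
  by_cases hq1 : q = 1
  · -- A pointwise limit of convex functions is convex.
    subst hq1
    refine ⟨convex_Icc 0 1, fun x hx y hy a b ha hb hab => ?_⟩
    refine le_of_tendsto_of_tendsto (tendsto_concurrenceT_one _)
      (((tendsto_concurrenceT_one x).const_smul a).add
        ((tendsto_concurrenceT_one y).const_smul b)) ?_
    have h1 : ∀ᶠ q : ℝ in 𝓝[≠] 1, q ∈ Set.Ioo (3 / 4 : ℝ) 2 :=
      nhdsWithin_le_nhds (Ioo_mem_nhds (by norm_num) (by norm_num))
    filter_upwards [h1, eventually_mem_nhdsWithin] with q hq hq1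
    exact (convexOn_concurrenceT_of_ne_one (by linarith [hq.1]) hq1
      (by nlinarith [hq.1, hq.2])).2 hx hy ha hb hab
  · have h13 : √13 ^ 2 = 13 := Real.sq_sqrt (by norm_num)
    have h0 : √13 < 4 := (Real.sqrt_lt' (by norm_num)).mpr (by norm_num)
    exact convexOn_concurrenceT_of_ne_one (by linarith [hq.1]) hq1
      (by nlinarith [hq.1, hq.2])

theorem concurrenceT_le_div_mul {q x y : ℝ} (hq0 : q ≠ 0)
    (hq : ConvexOn ℝ (Set.Icc 0 1) (concurrenceT q)) (hx : 0 ≤ x) (hxy : x ≤ y) (hy : y ≤ 1) :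
    concurrenceT q x ≤ x / y * concurrenceT q y := by
  rcases hx.eq_or_lt with rfl | hx
  · simp [concurrenceT_zero hq0]
  have hy0 : 0 < y := hx.trans_le hxy
  have h1 : x / y ≤ 1 := (div_le_one hy0).mpr hxy
  have := hq.2 (Set.left_mem_Icc.mpr zero_le_one) ⟨hy0.le, hy⟩ (sub_nonneg.mpr h1)
    (by positivity : 0 ≤ x / y) (by ring)
  simpa [concurrenceT_zero hq0, div_mul_cancel₀ _ hy0.ne'] using this

/-- Monogamy in terms of concurrences: by convexity and `concurrenceT q 0 = 0` the ratio
`concurrenceT q C / C` is nondecreasing, so its square may be summed against `C ^ 2`. -/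
theorem sum_concurrenceT_sq_le {ι : Type*} (t : Finset ι) {q : ℝ} (hq0 : q ≠ 0)
    (hq : ConvexOn ℝ (Set.Icc 0 1) (concurrenceT q)) (hn : ∀ C, 0 ≤ concurrenceT q C)
    (c : ι → ℝ) (hc : ∀ i ∈ t, 0 ≤ c i) {S : ℝ} (hS0 : 0 ≤ S) (hS1 : S ≤ 1)
    (hS : ∑ i ∈ t, c i ^ 2 = S ^ 2) :
    ∑ i ∈ t, concurrenceT q (c i) ^ 2 ≤ concurrenceT q S ^ 2 := by
  have hle : ∀ i ∈ t, c i ≤ S := fun i hi => by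
    refine (sq_le_sq₀ (hc i hi) hS0).mp ?_
    rw [← hS]
    exact Finset.single_le_sum (f := fun i => c i ^ 2) (fun j _ => sq_nonneg _) hi
  calc ∑ i ∈ t, concurrenceT q (c i) ^ 2
      ≤ ∑ i ∈ t, c i ^ 2 * (concurrenceT q S / S) ^ 2 := by
        refine Finset.sum_le_sum fun i hi => ?_
        rw [← mul_pow, mul_div_assoc', mul_div_right_comm]
        exact pow_le_pow_left₀ (hn _)
          (concurrenceT_le_div_mul hq0 hq (hc i hi) (hle i hi) hS1) 2
    _ = S ^ 2 * (concurrenceT q S / S) ^ 2 := by rw [← Finset.sum_mul, hS]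
    _ ≤ concurrenceT q S ^ 2 := by
        rcases eq_or_ne S 0 with rfl | h
        · simp [concurrenceT_zero hq0]
        · rw [← mul_pow, mul_div_cancel₀ _ h]

open Matrix

/-! ### Pure states supported on a cross -/

theorem trace_mul_self_eq_sum_sq_eigenvalues {α : Type*} [Fintype α] [DecidableEq α]
    {M : Matrix α α ℂ} (hM : M.IsHermitian) :
    (M * M).trace = ∑ i, (hM.eigenvalues i : ℂ) ^ 2 := by
  conv_lhs => rw [hM.spectral_theorem, ← map_mul, Unitary.conjStarAlgAut_apply,
    Matrix.trace_mul_cycle]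
  simp [Matrix.diagonal_mul_diagonal, Matrix.trace_diagonal, pow_two]

theorem rank_add_le {m n : Type*} [Fintype m] [Fintype n] (A B : Matrix m n ℂ) :
    (A + B).rank ≤ A.rank + B.rank := by
  have := LinearMap.rank_add_le A.mulVecLin B.mulVecLin
  rw [← Matrix.mulVecLin_add] at this
  simp only [LinearMap.rank, ← Module.finrank_eq_rank] at this
  exact_mod_cast this

/-- A spectrum with at most two nonzero entries is determined by its first two power sums. -/
theorem sum_eq_of_card_ne_zero_le_two {ι : Type*} [Fintype ι] (l : ι → ℝ) (f : ℝ → ℝ)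
    (hf : f 0 = 0) {D : ℝ} (hcard : (Finset.univ.filter fun i => l i ≠ 0).card ≤ 2)
    (h1 : ∑ i, l i = 1) (h2 : ∑ i, l i ^ 2 = 1 - 2 * D) :
    ∑ i, f (l i) = f ((1 + √(1 - 4 * D)) / 2) + f ((1 - √(1 - 4 * D)) / 2) := by
  have red : ∀ g : ℝ → ℝ, g 0 = 0 →
      ∑ i, g (l i) = ∑ i ∈ Finset.univ.filter (fun i => l i ≠ 0), g (l i) := by
    intro g hg
    refine (Finset.sum_subset (Finset.subset_univ _) fun i _ hi => ?_).symm
    have : l i = 0 := by simpa using hi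
    rw [this, hg]
  rw [red (fun x => x) rfl] at h1
  rw [red (fun x => x ^ 2) (by simp)] at h2
  rw [red f hf]
  interval_cases hc : (Finset.univ.filter fun i => l i ≠ 0).card
  · rw [Finset.card_eq_zero.mp hc] at h1
    simp at h1
  · obtain ⟨i, hi⟩ := Finset.card_eq_one.mp hc
    rw [hi, Finset.sum_singleton] at h1 h2 ⊢
    have hD : D = 0 := by rw [h1] at h2; linarith
    simp [h1, hD, hf]
  · classical
    obtain ⟨i, j, hij, hi⟩ := Finset.card_eq_two.mp hc
    rw [hi, Finset.sum_pair hij] at h1 h2 ⊢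
    have hsq : 1 - 4 * D = (l i - l j) ^ 2 := by nlinarith
    rw [hsq, Real.sqrt_sq_eq_abs]
    rcases abs_cases (l i - l j) with ⟨h, -⟩ | ⟨h, -⟩ <;> rw [h]
    · congr 2 <;> linarith
    · rw [add_comm]
      congr 2 <;> linarith

theorem tsallisEntropy_eq_sum {α : Type*} [Fintype α] [DecidableEq α] (q : ℝ)
    {M : Matrix α α ℂ} (hM : M.IsHermitian) (h1 : ∑ i, hM.eigenvalues i = 1) :
    tsallisEntropy q hM = ∑ i, entropySummand q (hM.eigenvalues i) := by
  unfold tsallisEntropy entropySummand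
  split_ifs with h
  · rfl
  · rw [← Finset.sum_div, Finset.sum_sub_distrib, h1]

/-- The weight of `φ` on the vectors `|a⟩|b₀⟩` with `a ≠ a₀`. -/
noncomputable def leftWeight {α β : Type*} [Fintype α] [DecidableEq α] (a₀ : α) (b₀ : β)
    (φ : α × β → ℂ) : ℝ :=
  ∑ a ∈ Finset.univ.erase a₀, ‖φ (a, b₀)‖ ^ 2

/-- The weight of `φ` on the vectors `|a₀⟩|b⟩` with `b ≠ b₀`. -/
noncomputable def rightWeight {α β : Type*} [Fintype β] [DecidableEq β] (a₀ : α) (b₀ : β)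
    (φ : α × β → ℂ) : ℝ :=
  ∑ b ∈ Finset.univ.erase b₀, ‖φ (a₀, b)‖ ^ 2

theorem leftWeight_nonneg {α β : Type*} [Fintype α] [DecidableEq α] (a₀ : α) (b₀ : β)
    (φ : α × β → ℂ) : 0 ≤ leftWeight a₀ b₀ φ :=
  Finset.sum_nonneg fun _ _ => sq_nonneg _

theorem rightWeight_nonneg {α β : Type*} [Fintype β] [DecidableEq β] (a₀ : α) (b₀ : β)
    (φ : α × β → ℂ) : 0 ≤ rightWeight a₀ b₀ φ :=
  Finset.sum_nonneg fun _ _ => sq_nonneg _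

/-- For a state supported on a cross this is the concurrence; its square is twice the linear
entropy of the marginal. -/
noncomputable def crossConcurrence {α β : Type*} [Fintype α] [Fintype β]
    [DecidableEq α] [DecidableEq β] (a₀ : α) (b₀ : β)
    (φ : α × β → ℂ) : ℝ :=
  2 * √(leftWeight a₀ b₀ φ) * √(rightWeight a₀ b₀ φ)

theorem leftWeight_add_rightWeight_le {α β : Type*} [Fintype α] [Fintype β]
    [DecidableEq α] [DecidableEq β] (a₀ : α) (b₀ : β) (φ : α × β → ℂ) :
    leftWeight a₀ b₀ φ + rightWeight a₀ b₀ φ ≤ ∑ x, ‖φ x‖ ^ 2 := by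
  have h : ∀ a ∈ Finset.univ.erase a₀, ‖φ (a, b₀)‖ ^ 2 ≤ ∑ b, ‖φ (a, b)‖ ^ 2 := fun a _ =>
    Finset.single_le_sum (f := fun b => ‖φ (a, b)‖ ^ 2) (fun _ _ => sq_nonneg _)
      (Finset.mem_univ b₀)
  have h' : rightWeight a₀ b₀ φ ≤ ∑ b, ‖φ (a₀, b)‖ ^ 2 :=
    Finset.sum_le_sum_of_subset_of_nonneg (Finset.subset_univ _) fun _ _ _ => sq_nonneg _
  rw [Fintype.sum_prod_type, ← Finset.sum_erase_add _ _ (Finset.mem_univ a₀)]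
  exact add_le_add (Finset.sum_le_sum h) h'

theorem crossConcurrence_mem_Icc {α β : Type*} [Fintype α] [Fintype β]
    [DecidableEq α] [DecidableEq β] (a₀ : α) (b₀ : β) {φ : α × β → ℂ} (hφ : ∑ x, ‖φ x‖ ^ 2 ≤ 1) :
    crossConcurrence a₀ b₀ φ ∈ Set.Icc (0 : ℝ) 1 := by
  refine ⟨by unfold crossConcurrence; positivity, ?_⟩
  have h := leftWeight_add_rightWeight_le a₀ b₀ φ
  have hx := Real.sq_sqrt (leftWeight_nonneg a₀ b₀ φ)
  have hy := Real.sq_sqrt (rightWeight_nonneg a₀ b₀ φ)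
  unfold crossConcurrence
  nlinarith [sq_nonneg (√(leftWeight a₀ b₀ φ) - √(rightWeight a₀ b₀ φ))]

theorem marginal_eq_of_cross {α β : Type*} [Fintype β] [DecidableEq α] [DecidableEq β]
    (a₀ : α) (b₀ : β) {φ : α × β → ℂ}
    (hφ : ∀ a b, a ≠ a₀ → b ≠ b₀ → φ (a, b) = 0) :
    marginal φ = vecMulVec (fun a => φ (a, b₀)) (star fun a => φ (a, b₀))
      + vecMulVec (Pi.single a₀ (rightWeight a₀ b₀ φ : ℂ)) (Pi.single a₀ 1) := by
  ext a a'
  simp only [marginal, proj, Matrix.of_apply, vecMulVec_apply, Pi.star_apply, Matrix.add_apply]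
  rw [← Finset.sum_erase_add _ _ (Finset.mem_univ b₀), add_comm]
  congr 1
  by_cases ha : a = a₀
  · subst ha
    by_cases ha' : a' = a
    · subst ha'
      simp [rightWeight, ← Complex.mul_conj']
    · rw [Pi.single_eq_of_ne ha', mul_zero]
      exact Finset.sum_eq_zero fun b hb => by simp [hφ a' b ha' (Finset.ne_of_mem_erase hb)]
  · rw [Pi.single_eq_of_ne ha, zero_mul]
    exact Finset.sum_eq_zero fun b hb => by simp [hφ a b ha (Finset.ne_of_mem_erase hb)]

/-- The marginal of a unit vector supported on a cross has rank at most two, so its entropy is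
that of a qubit. -/
theorem pureT_of_cross {α β : Type*} [Fintype α] [Fintype β]
    [DecidableEq α] [DecidableEq β] {q : ℝ} (hq : q ≠ 0) (a₀ : α) (b₀ : β) {φ : α × β → ℂ}
    (hunit : IsUnitVec φ) (hφ : ∀ a b, a ≠ a₀ → b ≠ b₀ → φ (a, b) = 0) :
    pureT q φ = concurrenceT q (crossConcurrence a₀ b₀ φ) := by
  have hM := marginal_isHermitian φ
  have hmar := marginal_eq_of_cross a₀ b₀ hφ
  set v : α → ℂ := fun a => φ (a, b₀) with hv
  have hvv : v ⬝ᵥ star v = ((leftWeight a₀ b₀ φ + ‖φ (a₀, b₀)‖ ^ 2 : ℝ) : ℂ) := by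
    simp only [dotProduct, Pi.star_apply, RCLike.star_def, Complex.mul_conj']
    rw [← Finset.sum_erase_add _ _ (Finset.mem_univ a₀)]
    simp [leftWeight, hv]
  have hN : leftWeight a₀ b₀ φ + ‖φ (a₀, b₀)‖ ^ 2 + rightWeight a₀ b₀ φ = 1 := by
    unfold IsUnitVec at hunit
    rw [Fintype.sum_prod_type, ← Finset.sum_erase_add _ _ (Finset.mem_univ a₀),
      ← Finset.sum_erase_add _ (fun b => ‖φ (a₀, b)‖ ^ 2) (Finset.mem_univ b₀)] at hunit
    have : ∑ a ∈ Finset.univ.erase a₀, ∑ b, ‖φ (a, b)‖ ^ 2 = leftWeight a₀ b₀ φ := by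
      refine Finset.sum_congr rfl fun a ha => ?_
      rw [Finset.sum_eq_single b₀ (fun b _ hb => by
        simp [hφ a b (Finset.ne_of_mem_erase ha) hb]) (by simp)]
    rw [this] at hunit
    unfold rightWeight
    linarith
  have htr : (marginal φ).trace = 1 := by
    rw [hmar, Matrix.trace_add, trace_vecMulVec, trace_vecMulVec, hvv, dotProduct_single,
      Pi.single_eq_same, mul_one, ← Complex.ofReal_add, hN, Complex.ofReal_one]
  have htr2 : (marginal φ * marginal φ).trace
      = ((1 - 2 * (leftWeight a₀ b₀ φ * rightWeight a₀ b₀ φ) : ℝ) : ℂ) := by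
    have h0 : φ (a₀, b₀) * star (φ (a₀, b₀)) = ((‖φ (a₀, b₀)‖ ^ 2 : ℝ) : ℂ) := by
      simp [Complex.mul_conj']
    have hN' : ‖φ (a₀, b₀)‖ ^ 2 = 1 - leftWeight a₀ b₀ φ - rightWeight a₀ b₀ φ := by linarith
    have e : (marginal φ * marginal φ).trace = (v ⬝ᵥ star v) ^ 2
        + 2 * (rightWeight a₀ b₀ φ : ℂ) * (φ (a₀, b₀) * star (φ (a₀, b₀)))
        + (rightWeight a₀ b₀ φ : ℂ) ^ 2 := by
      rw [hmar]
      simp only [add_mul, mul_add, vecMulVec_mul_vecMulVec, Matrix.trace_add, trace_vecMulVec,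
        dotProduct_smul, smul_eq_mul, dotProduct_comm (star v) v]
      simp [hv]
      ring
    rw [e, hvv, h0, hN']
    push_cast
    ring
  have hrank : (marginal φ).rank ≤ 2 := by
    rw [hmar]
    exact (rank_add_le _ _).trans (add_le_add (rank_vecMulVec_le _ _) (rank_vecMulVec_le _ _))
  have h1 : ∑ i, hM.eigenvalues i = 1 := by
    rw [hM.trace_eq_sum_eigenvalues, ← RCLike.ofReal_sum] at htr
    exact Complex.ofReal_injective htr
  have h2 : ∑ i, hM.eigenvalues i ^ 2
      = 1 - 2 * (leftWeight a₀ b₀ φ * rightWeight a₀ b₀ φ) := by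
    rw [trace_mul_self_eq_sum_sq_eigenvalues hM] at htr2
    exact_mod_cast htr2
  have hcard : (Finset.univ.filter fun i => hM.eigenvalues i ≠ 0).card ≤ 2 := by
    rw [hM.rank_eq_card_non_zero_eigs, Fintype.card_subtype] at hrank
    exact hrank
  have hC : crossConcurrence a₀ b₀ φ ^ 2 = 4 * (leftWeight a₀ b₀ φ * rightWeight a₀ b₀ φ) := by
    rw [crossConcurrence, mul_pow, mul_pow, Real.sq_sqrt (leftWeight_nonneg _ _ _),
      Real.sq_sqrt (rightWeight_nonneg _ _ _)]
    ring
  rw [pureT, tsallisEntropy_eq_sum q _ h1, concurrenceT, hC]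
  exact sum_eq_of_card_ne_zero_le_two _ _ (entropySummand_zero hq) hcard h1 h2

/-! ### Mixtures of a cross state with a product state -/

theorem dotProduct_proj_mulVec {κ : Type*} [Fintype κ] (u φ : κ → ℂ) :
    u ⬝ᵥ (proj φ *ᵥ star u) = ((‖u ⬝ᵥ φ‖ ^ 2 : ℝ) : ℂ) := by
  rw [proj, vecMulVec_mulVec, Complex.ofReal_pow, ← Complex.mul_conj', ← RCLike.star_def,
    ← star_dotProduct_star]
  simp [dotProduct_smul, mul_comm]

/-- All pure state decompositions of `|φ⟩⟨φ| + Z |x₀⟩⟨x₀|` have the same quadratic form. -/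
theorem IsPureDecomposition.sum_norm_sq {κ : Type*} [Fintype κ] [DecidableEq κ] {φ : κ → ℂ}
    {x₀ : κ} {Z : ℝ} {N : ℕ} {w : Fin N → ℝ} {χ : Fin N → κ → ℂ}
    (h : IsPureDecomposition (proj φ + (Z : ℂ) • proj (Pi.single x₀ 1)) w χ) (u : κ → ℂ) :
    ∑ i, w i * ‖u ⬝ᵥ χ i‖ ^ 2 = ‖u ⬝ᵥ φ‖ ^ 2 + Z * ‖u x₀‖ ^ 2 := by
  have := congrArg (fun M => u ⬝ᵥ (M *ᵥ star u)) h.eq_sum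
  simp only [add_mulVec, Matrix.sum_mulVec, smul_mulVec, dotProduct_add, dotProduct_sum,
    dotProduct_smul, dotProduct_proj_mulVec, smul_eq_mul, dotProduct_single, mul_one] at this
  exact_mod_cast this.symm

/-- Every member of a pure state decomposition of `|φ⟩⟨φ| + Z |a₀b₀⟩⟨a₀b₀|`, with `φ` supported on
a cross, is supported on the same cross with left and right weights in the same proportion as
those of `φ`; hence all decompositions have the same average concurrence. -/
theorem IsPureDecomposition.cross {α β : Type*} [Fintype α] [Fintype β]
    [DecidableEq α] [DecidableEq β] {a₀ : α} {b₀ : β} {φ : α × β → ℂ} {Z : ℝ}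
    (hφ : ∀ a b, a ≠ a₀ → b ≠ b₀ → φ (a, b) = 0)
    {N : ℕ} {w : Fin N → ℝ} {χ : Fin N → α × β → ℂ}
    (h : IsPureDecomposition (proj φ + (Z : ℂ) • proj (Pi.single (a₀, b₀) 1)) w χ) :
    (∀ i, w i ≠ 0 → ∀ a b, a ≠ a₀ → b ≠ b₀ → χ i (a, b) = 0) ∧
      ∑ i, w i * crossConcurrence a₀ b₀ (χ i) = crossConcurrence a₀ b₀ φ := by
  have hz : ∀ u : α × β → ℂ, u ⬝ᵥ φ = 0 → u (a₀, b₀) = 0 → ∀ i, w i ≠ 0 → u ⬝ᵥ χ i = 0 := by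
    intro u hu hu0 i hi
    have := h.sum_norm_sq u
    rw [hu, hu0, norm_zero] at this
    rw [zero_pow two_ne_zero, mul_zero, add_zero, Finset.sum_eq_zero_iff_of_nonneg
      (fun i _ => mul_nonneg (h.nonneg i) (sq_nonneg _))] at this
    simpa [hi] using this i (Finset.mem_univ i)
  have hcoord : ∀ x, x ≠ (a₀, b₀) → ∑ i, w i * ‖χ i x‖ ^ 2 = ‖φ x‖ ^ 2 := by
    intro x hx
    have := h.sum_norm_sq (Pi.single x 1)
    simpa [hx.symm] using this
  have hX : ∑ i, w i * leftWeight a₀ b₀ (χ i) = leftWeight a₀ b₀ φ := by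
    simp only [leftWeight, Finset.mul_sum]
    rw [Finset.sum_comm]
    exact Finset.sum_congr rfl fun a ha => hcoord _ (by simp [Finset.ne_of_mem_erase ha])
  have hprop : ∀ i, w i ≠ 0 → rightWeight a₀ b₀ φ * leftWeight a₀ b₀ (χ i)
      = leftWeight a₀ b₀ φ * rightWeight a₀ b₀ (χ i) := by
    intro i hi
    simp only [leftWeight, rightWeight]
    rw [Finset.sum_mul_sum, Finset.sum_mul_sum, Finset.sum_comm]
    refine Finset.sum_congr rfl fun a ha => Finset.sum_congr rfl fun b hb => ?_
    have ha := Finset.ne_of_mem_erase ha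
    have hb := Finset.ne_of_mem_erase hb
    have := hz (Pi.single (a, b₀) (φ (a₀, b)) - Pi.single (a₀, b) (φ (a, b₀)))
      (by simp [sub_dotProduct, mul_comm]) (by simp [ha.symm, hb.symm]) i hi
    rw [sub_dotProduct, single_dotProduct, single_dotProduct, sub_eq_zero] at this
    rw [← mul_pow, ← mul_pow, ← norm_mul, ← norm_mul, this]
  refine ⟨fun i hi a b ha hb => ?_, ?_⟩
  · simpa using hz (Pi.single (a, b) 1) (by simp [hφ a b ha hb]) (by simp [ha.symm]) i hi
  rcases (leftWeight_nonneg a₀ b₀ φ).eq_or_lt with hX0 | hX0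
  · rw [← hX0, Finset.sum_eq_zero_iff_of_nonneg
      (fun i _ => mul_nonneg (h.nonneg i) (leftWeight_nonneg _ _ _))] at hX
    rw [crossConcurrence, ← hX0, Real.sqrt_zero, mul_zero, zero_mul]
    refine Finset.sum_eq_zero fun i hi => ?_
    rcases mul_eq_zero.mp (hX i hi) with h0 | h0 <;> simp [crossConcurrence, h0]
  · have hterm : ∀ i, w i * crossConcurrence a₀ b₀ (χ i) = w i * leftWeight a₀ b₀ (χ i)
        * (2 * √(rightWeight a₀ b₀ φ) / √(leftWeight a₀ b₀ φ)) := by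
      intro i
      rcases eq_or_ne (w i) 0 with h0 | h0
      · simp [h0]
      have hs := Real.sqrt_pos.mpr hX0
      have e : √(leftWeight a₀ b₀ φ) * √(rightWeight a₀ b₀ (χ i))
          = √(rightWeight a₀ b₀ φ) * √(leftWeight a₀ b₀ (χ i)) := by
        rw [← Real.sqrt_mul hX0.le, ← Real.sqrt_mul (rightWeight_nonneg _ _ _), hprop i h0]
      have hsq := Real.mul_self_sqrt (leftWeight_nonneg a₀ b₀ (χ i))
      rw [crossConcurrence, mul_assoc (w i)]
      congr 1
      rw [mul_div_assoc', eq_div_iff hs.ne']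
      linear_combination 2 * √(leftWeight a₀ b₀ (χ i)) * e + 2 * √(rightWeight a₀ b₀ φ) * hsq
    rw [Finset.sum_congr rfl fun i _ => hterm i, ← Finset.sum_mul, hX, crossConcurrence]
    have hs := (Real.sqrt_pos.mpr hX0).ne'
    have hsq := Real.mul_self_sqrt hX0.le
    rw [mul_div_assoc', div_eq_iff hs]
    linear_combination -2 * √(rightWeight a₀ b₀ φ) * hsq

/-- Convexity bounds every decomposition from below by the entropy at the average concurrence.
The decomposition into `φ ± i √Z |a₀b₀⟩`, each of the concurrence of `φ`, attains the bound;
these vectors are normalised because the coefficient of `φ` at `(a₀, b₀)` is real. -/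
theorem mixedT_cross {α β : Type*} [Fintype α] [Fintype β]
    [DecidableEq α] [DecidableEq β] {q : ℝ} (hq0 : q ≠ 0)
    (hq : ConvexOn ℝ (Set.Icc 0 1) (concurrenceT q)) (a₀ : α) (b₀ : β) {φ : α × β → ℂ}
    (hφ : ∀ a b, a ≠ a₀ → b ≠ b₀ → φ (a, b) = 0) (him : (φ (a₀, b₀)).im = 0) {Z : ℝ}
    (hZ : 0 ≤ Z) (hnorm : ∑ x, ‖φ x‖ ^ 2 + Z = 1) :
    mixedT q (proj φ + (Z : ℂ) • proj (Pi.single (a₀, b₀) 1))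
      = concurrenceT q (crossConcurrence a₀ b₀ φ) := by
  refine IsLeast.csInf_eq ⟨?_, ?_⟩
  · have hpm : ∀ c : ℂ, c.re = 0 → ‖c‖ ^ 2 = Z →
        IsUnitVec (φ + c • (Pi.single (a₀, b₀) 1 : α × β → ℂ)) ∧
          pureT q (φ + c • (Pi.single (a₀, b₀) 1 : α × β → ℂ))
            = concurrenceT q (crossConcurrence a₀ b₀ φ) := by
      intro c hc hcZ
      have hne : ∀ x, x ≠ (a₀, b₀) → (φ + c • (Pi.single (a₀, b₀) 1 : α × β → ℂ)) x = φ x := by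
        intro x hx
        simp [hx]
      have hunit : IsUnitVec (φ + c • (Pi.single (a₀, b₀) 1 : α × β → ℂ)) := by
        unfold IsUnitVec
        rw [← Finset.sum_erase_add _ _ (Finset.mem_univ (a₀, b₀)), Finset.sum_congr rfl
          fun x hx => by rw [hne x (Finset.ne_of_mem_erase hx)]]
        rw [← Finset.sum_erase_add _ _ (Finset.mem_univ (a₀, b₀))] at hnorm
        have : ‖(φ + c • (Pi.single (a₀, b₀) 1 : α × β → ℂ)) (a₀, b₀)‖ ^ 2
            = ‖φ (a₀, b₀)‖ ^ 2 + Z := by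
          rw [← hcZ]
          simp only [Complex.sq_norm, Complex.normSq_apply, Pi.add_apply, Pi.smul_apply,
            Pi.single_eq_same, smul_eq_mul, mul_one, Complex.add_re, Complex.add_im, hc, him]
          ring
        rw [this]
        linarith
      refine ⟨hunit, ?_⟩
      rw [pureT_of_cross hq0 a₀ b₀ hunit fun a b ha hb => by
        rw [hne _ (by simp [ha]), hφ a b ha hb]]
      have hl : leftWeight a₀ b₀ (φ + c • (Pi.single (a₀, b₀) 1 : α × β → ℂ))
          = leftWeight a₀ b₀ φ :=
        Finset.sum_congr rfl fun a ha => by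
          rw [hne _ (by simp [Finset.ne_of_mem_erase ha])]
      have hr : rightWeight a₀ b₀ (φ + c • (Pi.single (a₀, b₀) 1 : α × β → ℂ))
          = rightWeight a₀ b₀ φ :=
        Finset.sum_congr rfl fun b hb => by
          rw [hne _ (by simp [Finset.ne_of_mem_erase hb])]
      rw [crossConcurrence, hl, hr, crossConcurrence]
    have hcZ : ‖(√Z : ℂ) * Complex.I‖ ^ 2 = Z := by
      simp [Real.sq_sqrt hZ]
    have hp := hpm ((√Z : ℂ) * Complex.I) (by simp) hcZ
    have hm := hpm (-((√Z : ℂ) * Complex.I)) (by simp) (by rw [norm_neg, hcZ])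
    refine ⟨2, fun _ => 1 / 2, ![φ + ((√Z : ℂ) * Complex.I) • (Pi.single (a₀, b₀) 1 : α × β → ℂ),
      φ + (-((√Z : ℂ) * Complex.I)) • (Pi.single (a₀, b₀) 1 : α × β → ℂ)], ⟨fun _ => by norm_num,
      by norm_num, ?_, ?_⟩, ?_⟩
    · intro i
      fin_cases i
      · exact hp.1
      · exact hm.1
    · have hZZ : (√Z : ℂ) * (√Z : ℂ) = Z := by
        rw [← Complex.ofReal_mul, Real.mul_self_sqrt hZ]
      ext x y
      simp only [proj, Fin.sum_univ_two, Matrix.add_apply, Matrix.smul_apply, vecMulVec_apply,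
        Matrix.cons_val_zero, Matrix.cons_val_one, Pi.add_apply, Pi.smul_apply, Pi.star_apply,
        smul_eq_mul, star_add, star_mul', star_neg, RCLike.star_def, Complex.conj_ofReal,
        Complex.conj_I]
      push_cast
      linear_combination (-(Pi.single (a₀, b₀) 1 : α × β → ℂ) x
        * (starRingEnd ℂ) ((Pi.single (a₀, b₀) 1 : α × β → ℂ) y)) * hZZ
        + ((√Z : ℂ) * (√Z : ℂ) * (Pi.single (a₀, b₀) 1 : α × β → ℂ) x
        * (starRingEnd ℂ) ((Pi.single (a₀, b₀) 1 : α × β → ℂ) y)) * Complex.I_mul_I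
    · simp only [Fin.sum_univ_two, Matrix.cons_val_zero, Matrix.cons_val_one, hp.2, hm.2]
      ring
  · rintro t ⟨N, w, χ, h, rfl⟩
    obtain ⟨hsupp, hsum⟩ := h.cross hφ
    have hJ := hq.map_sum_le (t := Finset.univ) (w := w)
      (p := fun i => crossConcurrence a₀ b₀ (χ i)) (fun i _ => h.nonneg i) h.sum_eq_one
      (fun i _ => crossConcurrence_mem_Icc a₀ b₀ (h.unit i).le)
    simp only [smul_eq_mul, hsum] at hJ
    refine hJ.trans_eq (Finset.sum_congr rfl fun i _ => ?_)
    rcases eq_or_ne (w i) 0 with h0 | h0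
    · simp [h0]
    · rw [pureT_of_cross hq0 a₀ b₀ (h.unit i) (hsupp i h0)]

/-! ### Weighted sums with Hamming weights -/

theorem hammingWeight_zero : hammingWeight 0 = 0 := by simp [hammingWeight]

theorem hammingWeight_two_mul (j : ℕ) : hammingWeight (2 * j) = hammingWeight j := by
  rcases Nat.eq_zero_or_pos j with rfl | h
  · rfl
  · rw [hammingWeight, Nat.digits_def' one_lt_two (by omega)]
    simp [hammingWeight]

theorem hammingWeight_two_mul_add_one (j : ℕ) :
    hammingWeight (2 * j + 1) = hammingWeight j + 1 := by
  rw [hammingWeight, Nat.digits_def' one_lt_two (by omega), Nat.mul_add_div two_pos,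
    Nat.mul_add_mod]
  simp [hammingWeight]

theorem K_nonneg {k β : ℝ} (hk : 0 < k) (hβ : 2 ≤ β) : 0 ≤ K k β :=
  div_nonneg (sub_nonneg.mpr (Real.one_le_rpow (by linarith) (by linarith)))
    (Real.rpow_nonneg hk.le _)

theorem _root_.ConvexOn.add_le_add_of_le {s : Set ℝ} {f : ℝ → ℝ} (hf : ConvexOn ℝ s f) {x y h : ℝ}
    (hx : x ∈ s) (hy : y + h ∈ s) (hxy : x ≤ y) (hh : 0 ≤ h) :
    f y + f (x + h) ≤ f x + f (y + h) := by
  rcases (add_nonneg (sub_nonneg.mpr hxy) hh).eq_or_lt with h0 | h0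
  · have hx' : x = y := by linarith
    rw [hx']
  -- `y` and `x + h` are complementary convex combinations of `x` and `y + h`.
  have h1 := hf.2 hx hy (by positivity : 0 ≤ h / (y - x + h))
    (div_nonneg (sub_nonneg.mpr hxy) h0.le) (by rw [← add_div, add_comm h, div_self h0.ne'])
  have h2 := hf.2 hx hy (div_nonneg (sub_nonneg.mpr hxy) h0.le)
    (by positivity : 0 ≤ h / (y - x + h)) (by rw [← add_div, div_self h0.ne'])
  simp only [smul_eq_mul] at h1 h2
  have e1 : h / (y - x + h) * x + (y - x) / (y - x + h) * (y + h) = y := by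
    field_simp
    ring
  have e2 : (y - x) / (y - x + h) * x + h / (y - x + h) * (y + h) = x + h := by
    field_simp
    ring
  have e3 : h / (y - x + h) + (y - x) / (y - x + h) = 1 := by
    rw [← add_div, add_comm h, div_self h0.ne']
  rw [e1] at h1
  rw [e2] at h2
  linear_combination h1 + h2 + (f x + f (y + h)) * e3

/-- The increment of the convex function `x ↦ x ^ (β / 2)` over an interval of length `B` is larger
when starting at `A` than when starting at `B / k ≤ A`. -/
theorem rpow_add_K_mul_rpow_le {k β A B : ℝ} (hk : 0 < k) (hβ : 2 ≤ β) (hB : 0 ≤ B)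
    (hBA : B ≤ k * A) :
    A ^ (β / 2) + K k β * B ^ (β / 2) ≤ (A + B) ^ (β / 2) := by
  have hC : 0 ≤ B / k := by positivity
  have hCA : B / k ≤ A := by rwa [div_le_iff₀' hk]
  have h := (convexOn_rpow (by linarith : 1 ≤ β / 2)).add_le_add_of_le (Set.mem_Ici.mpr hC)
    (Set.mem_Ici.mpr (by linarith : 0 ≤ A + B)) hCA hB
  have e : B / k + B = (1 + k) * (B / k) := by field_simp
  rw [e, Real.mul_rpow (by linarith) hC, Real.div_rpow hB hk.le] at h
  rw [K, div_mul_eq_mul_div, mul_div_assoc]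
  linarith

/-- Neighbouring terms `2 * i` and `2 * i + 1` are merged into one; this adds one to the Hamming
weight of the second and keeps the decay of the sequence. -/
theorem sum_K_pow_hammingWeight_mul_rpow_le {k β : ℝ} (hk : 0 < k) (hk1 : k ≤ 1) (hβ : 2 ≤ β)
    (n : ℕ) (x : ℕ → ℝ) (hx : ∀ i, 0 ≤ x i) (hdec : ∀ i, x (i + 1) ≤ k * x i) :
    ∑ j ∈ Finset.range (2 ^ n), K k β ^ hammingWeight j * x j ^ (β / 2)
      ≤ (∑ j ∈ Finset.range (2 ^ n), x j) ^ (β / 2) := by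
  induction n generalizing x with
  | zero => simp [hammingWeight_zero]
  | succ n ih =>
    have split : ∀ f : ℕ → ℝ, ∑ j ∈ Finset.range (2 ^ (n + 1)), f j
        = ∑ i ∈ Finset.range (2 ^ n), (f (2 * i) + f (2 * i + 1)) := by
      intro f
      rw [pow_succ, mul_comm]
      generalize 2 ^ n = N
      induction N with
      | zero => simp
      | succ N ihN =>
        rw [Finset.sum_range_succ, ← ihN, Nat.mul_succ, Finset.sum_range_succ,
          Finset.sum_range_succ, add_assoc]
    rw [split, split]
    have hle : ∀ i, x (i + 1) ≤ x i := fun i =>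
      (hdec i).trans (mul_le_of_le_one_left (hx i) hk1)
    refine le_trans (Finset.sum_le_sum fun i _ => ?_)
      (ih (fun i => x (2 * i) + x (2 * i + 1)) (fun i => add_nonneg (hx _) (hx _)) fun i => ?_)
    · rw [hammingWeight_two_mul, hammingWeight_two_mul_add_one, pow_succ, mul_assoc, ← mul_add]
      exact mul_le_mul_of_nonneg_left
        (rpow_add_K_mul_rpow_le hk hβ (hx _) (hdec _)) (pow_nonneg (K_nonneg hk hβ) _)
    · rw [mul_add k]
      exact add_le_add ((hdec (2 * i + 1)).trans (mul_le_mul_of_nonneg_left (hle _) hk.le))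
        ((hdec (2 * i + 2)).trans (mul_le_mul_of_nonneg_left
          ((hle (2 * i + 1))) hk.le))

/-! ### States with at most one excitation -/

theorem glue_zero {n d : ℕ} [NeZero d] (P Q : Finset (Fin n)) : glue (d := d) P Q 0 0 0 = 0 := by
  funext s
  simp [glue]

theorem glue_left {n d : ℕ} {P Q : Finset (Fin n)} (a : P → Fin d) (b : Q → Fin d)
    (e : {s : Fin n // s ∉ P ∪ Q} → Fin d) (s : P) : glue P Q a b e s = a s := by
  simp [glue]

theorem glue_right {n d : ℕ} {P Q : Finset (Fin n)} (h : Disjoint P Q) (a : P → Fin d)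
    (b : Q → Fin d) (e : {s : Fin n // s ∉ P ∪ Q} → Fin d) (s : Q) : glue P Q a b e s = b s := by
  simp [glue, Finset.disjoint_right.mp h s.2]

theorem glue_rest {n d : ℕ} {P Q : Finset (Fin n)} (a : P → Fin d) (b : Q → Fin d)
    (e : {s : Fin n // s ∉ P ∪ Q} → Fin d) (s : {s : Fin n // s ∉ P ∪ Q}) :
    glue P Q a b e s = e s := by
  have h := s.2
  rw [Finset.mem_union, not_or] at h
  simp [glue, h.1, h.2]

/-- A configuration of all parties is a triple of configurations on `P`, on `Q` and on the rest. -/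
def glueEquiv {n d : ℕ} {P Q : Finset (Fin n)} (h : Disjoint P Q) :
    ((P → Fin d) × (Q → Fin d)) × ({s : Fin n // s ∉ P ∪ Q} → Fin d) ≃ (Fin n → Fin d) where
  toFun x := glue P Q x.1.1 x.1.2 x.2
  invFun f := ((fun s => f s, fun s => f s), fun s => f s)
  left_inv x := by
    simp only [glue_left, glue_right h, glue_rest]
  right_inv f := by
    funext s
    simp [glue]

theorem sum_glue {n d : ℕ} {P Q : Finset (Fin n)} (h : Disjoint P Q) (F : (Fin n → Fin d) → ℝ) :
    ∑ f, F f = ∑ a : P → Fin d, ∑ b : Q → Fin d, ∑ e, F (glue P Q a b e) := by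
  rw [← (glueEquiv h).sum_comp F, Fintype.sum_prod_type, Fintype.sum_prod_type]
  rfl

/-- `ψ` has no component with two or more excited parties. -/
def SingleExcitation {n d : ℕ} [NeZero d] (ψ : (Fin n → Fin d) → ℂ) : Prop :=
  ∀ f s t, s ≠ t → f s ≠ 0 → f t ≠ 0 → ψ f = 0

/-- The probability that party `s` is excited. -/
noncomputable def siteWeight {n d : ℕ} [NeZero d] (ψ : (Fin n → Fin d) → ℂ) (s : Fin n) : ℝ :=
  ∑ f, if f s ≠ 0 then ‖ψ f‖ ^ 2 else 0

theorem siteWeight_nonneg {n d : ℕ} [NeZero d] (ψ : (Fin n → Fin d) → ℂ) (s : Fin n) :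
    0 ≤ siteWeight ψ s :=
  Finset.sum_nonneg fun f _ => by split_ifs <;> positivity

/-- The component of `ψ` with all parties outside `P ∪ Q` in the ground state. -/
def groundComponent {n d : ℕ} [NeZero d] (ψ : (Fin n → Fin d) → ℂ) (P Q : Finset (Fin n)) :
    (P → Fin d) × (Q → Fin d) → ℂ :=
  fun x => ψ (glue P Q x.1 x.2 0)

/-- The concurrence of the reduced state with respect to `P | Q`. -/
noncomputable def concurrence {n d : ℕ} [NeZero d] (ψ : (Fin n → Fin d) → ℂ)
    (P Q : Finset (Fin n)) : ℝ :=
  2 * √(∑ s ∈ P, siteWeight ψ s) * √(∑ s ∈ Q, siteWeight ψ s)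

/-- The squared concurrence is additive in the second subsystem. -/
theorem sum_concurrence_sq {n d r : ℕ} [NeZero d] (ψ : (Fin n → Fin d) → ℂ)
    (P : Finset (Fin n)) {Q : Fin r → Finset (Fin n)}
    (hQQ : ∀ i j, i ≠ j → Disjoint (Q i) (Q j)) :
    ∑ j, concurrence ψ P (Q j) ^ 2 = concurrence ψ P (Finset.univ.biUnion Q) ^ 2 := by
  have hn : ∀ R : Finset (Fin n), 0 ≤ ∑ s ∈ R, siteWeight ψ s := fun R =>
    Finset.sum_nonneg fun s _ => siteWeight_nonneg ψ s
  simp only [concurrence, mul_pow, Real.sq_sqrt (hn _)]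
  rw [← Finset.mul_sum, Finset.sum_biUnion fun i _ j _ hij => hQQ i j hij]

namespace SingleExcitation

variable {n d : ℕ} [NeZero d] {ψ : (Fin n → Fin d) → ℂ} {P Q : Finset (Fin n)}

theorem glue_left_right (hψ : SingleExcitation ψ) (h : Disjoint P Q) {a : P → Fin d}
    {b : Q → Fin d} (e : {s : Fin n // s ∉ P ∪ Q} → Fin d) (ha : a ≠ 0) (hb : b ≠ 0) :
    ψ (glue P Q a b e) = 0 := by
  obtain ⟨s, hs⟩ := Function.ne_iff.mp ha
  obtain ⟨t, ht⟩ := Function.ne_iff.mp hb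
  refine hψ _ s t (fun hst => Finset.disjoint_left.mp h s.2 (hst ▸ t.2)) ?_ ?_
  · rwa [glue_left]
  · rwa [glue_right h]

theorem glue_left_rest (hψ : SingleExcitation ψ) {a : P → Fin d} (b : Q → Fin d)
    {e : {s : Fin n // s ∉ P ∪ Q} → Fin d} (ha : a ≠ 0) (he : e ≠ 0) :
    ψ (glue P Q a b e) = 0 := by
  obtain ⟨s, hs⟩ := Function.ne_iff.mp ha
  obtain ⟨t, ht⟩ := Function.ne_iff.mp he
  refine hψ _ s t (fun hst => t.2 (hst ▸ Finset.mem_union_left _ s.2)) ?_ ?_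
  · rwa [glue_left]
  · rwa [glue_rest]

theorem glue_right_rest (hψ : SingleExcitation ψ) (h : Disjoint P Q) (a : P → Fin d)
    {b : Q → Fin d} {e : {s : Fin n // s ∉ P ∪ Q} → Fin d} (hb : b ≠ 0) (he : e ≠ 0) :
    ψ (glue P Q a b e) = 0 := by
  obtain ⟨s, hs⟩ := Function.ne_iff.mp hb
  obtain ⟨t, ht⟩ := Function.ne_iff.mp he
  refine hψ _ s t (fun hst => t.2 (hst ▸ Finset.mem_union_right _ s.2)) ?_ ?_
  · rwa [glue_right h]
  · rwa [glue_rest]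

theorem glue_rest_eq_zero (hψ : SingleExcitation ψ) (h : Disjoint P Q)
    {x : (P → Fin d) × (Q → Fin d)} (hx : x ≠ (0, 0))
    {e : {s : Fin n // s ∉ P ∪ Q} → Fin d} (he : e ≠ 0) : ψ (glue P Q x.1 x.2 e) = 0 := by
  by_cases h1 : x.1 = 0
  · exact hψ.glue_right_rest h _ (fun h2 => hx (Prod.ext h1 h2)) he
  · exact hψ.glue_left_rest _ h1 he

/-- Tracing out parties leaves the ground component, mixed incoherently with `|0⟩|0⟩`. -/
theorem reduced_eq (hψ : SingleExcitation ψ) (h : Disjoint P Q) :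
    reduced (proj ψ) P Q = proj (groundComponent ψ P Q)
      + ((∑ e ∈ Finset.univ.erase 0, ‖ψ (glue P Q 0 0 e)‖ ^ 2 : ℝ) : ℂ)
        • proj (Pi.single (0, 0) 1) := by
  ext x y
  simp only [reduced, proj, Matrix.of_apply, Matrix.vecMulVec_apply, Pi.star_apply,
    Matrix.add_apply, Matrix.smul_apply, smul_eq_mul, groundComponent]
  rw [← Finset.sum_erase_add _ _ (Finset.mem_univ 0), add_comm]
  congr 1
  by_cases hx : x = (0, 0)
  · by_cases hy : y = (0, 0)
    · subst hx hy
      simp [← Complex.mul_conj']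
    · rw [Pi.single_eq_of_ne hy, star_zero, mul_zero, mul_zero]
      exact Finset.sum_eq_zero fun e he => by
        rw [hψ.glue_rest_eq_zero h hy (Finset.ne_of_mem_erase he), star_zero, mul_zero]
  · rw [Pi.single_eq_of_ne hx, zero_mul, mul_zero]
    exact Finset.sum_eq_zero fun e he => by
      rw [hψ.glue_rest_eq_zero h hx (Finset.ne_of_mem_erase he), zero_mul]

theorem sum_norm_sq_groundComponent (hψ : SingleExcitation ψ) (h : Disjoint P Q) :
    ∑ x, ‖groundComponent ψ P Q x‖ ^ 2
      + ∑ e ∈ Finset.univ.erase 0, ‖ψ (glue P Q 0 0 e)‖ ^ 2 = ∑ f, ‖ψ f‖ ^ 2 := by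
  rw [← (glueEquiv h).sum_comp (fun f => ‖ψ f‖ ^ 2),
    Fintype.sum_prod_type (fun x => ‖ψ (glueEquiv h x)‖ ^ 2)]
  have : ∀ x : (P → Fin d) × (Q → Fin d), ∑ e, ‖ψ (glueEquiv h (x, e))‖ ^ 2
      = ∑ e ∈ Finset.univ.erase 0, ‖ψ (glue P Q x.1 x.2 e)‖ ^ 2
        + ‖groundComponent ψ P Q x‖ ^ 2 := fun x => by
    rw [← Finset.sum_erase_add _ _ (Finset.mem_univ 0)]
    rfl
  rw [Finset.sum_congr rfl fun x _ => this x, Finset.sum_add_distrib, add_comm]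
  congr 1
  symm
  rw [Fintype.sum_eq_single (0, 0)]
  intro x hx
  exact Finset.sum_eq_zero fun e he => by
    rw [hψ.glue_rest_eq_zero h hx (Finset.ne_of_mem_erase he), norm_zero, zero_pow two_ne_zero]

/-- At most one party of `P` is excited, so the probabilities of excitation add up. -/
theorem sum_siteWeight (hψ : SingleExcitation ψ) (P : Finset (Fin n)) :
    ∑ s ∈ P, siteWeight ψ s = ∑ f, if ∃ s ∈ P, f s ≠ 0 then ‖ψ f‖ ^ 2 else 0 := by
  simp only [siteWeight]
  rw [Finset.sum_comm]
  refine Finset.sum_congr rfl fun f _ => ?_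
  split_ifs with hf
  · obtain ⟨s, hs, hfs⟩ := hf
    rw [Finset.sum_eq_single_of_mem s hs, if_pos hfs]
    intro t _ hts
    split_ifs with hft
    · simp [hψ f t s hts hft hfs]
    · rfl
  · push Not at hf
    exact Finset.sum_eq_zero fun s hs => if_neg (not_not.mpr (hf s hs))

theorem leftWeight_groundComponent (hψ : SingleExcitation ψ) (h : Disjoint P Q) :
    leftWeight 0 0 (groundComponent ψ P Q) = ∑ s ∈ P, siteWeight ψ s := by
  rw [hψ.sum_siteWeight, sum_glue h, leftWeight]
  rw [← Finset.sum_erase_add _ _ (Finset.mem_univ (0 : P → Fin d))]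
  rw [Finset.sum_eq_zero (s := Finset.univ (α := Q → Fin d)), add_zero]
  · refine Finset.sum_congr rfl fun a ha => ?_
    have ha := Finset.ne_of_mem_erase ha
    rw [Fintype.sum_eq_single 0, Fintype.sum_eq_single 0, if_pos]
    · rfl
    · obtain ⟨s, hs⟩ := Function.ne_iff.mp ha
      exact ⟨s, s.2, by rwa [glue_left]⟩
    · intro e he
      simp [hψ.glue_left_rest _ ha he]
    · intro b hb
      simp [hψ.glue_left_right h _ ha hb]
  · intro b _
    refine Finset.sum_eq_zero fun e _ => if_neg ?_
    rintro ⟨s, hs, hne⟩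
    exact hne (by rw [glue_left _ _ _ ⟨s, hs⟩]; rfl)

theorem rightWeight_groundComponent (hψ : SingleExcitation ψ) (h : Disjoint P Q) :
    rightWeight 0 0 (groundComponent ψ P Q) = ∑ s ∈ Q, siteWeight ψ s := by
  rw [hψ.sum_siteWeight, sum_glue h, rightWeight, Finset.sum_comm]
  rw [← Finset.sum_erase_add _ _ (Finset.mem_univ (0 : Q → Fin d))]
  rw [Finset.sum_eq_zero (s := Finset.univ (α := P → Fin d)), add_zero]
  · refine Finset.sum_congr rfl fun b hb => ?_
    have hb := Finset.ne_of_mem_erase hb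
    rw [Fintype.sum_eq_single 0, Fintype.sum_eq_single 0, if_pos]
    · rfl
    · obtain ⟨s, hs⟩ := Function.ne_iff.mp hb
      exact ⟨s, s.2, by rwa [glue_right h]⟩
    · intro e he
      simp [hψ.glue_right_rest h _ hb he]
    · intro a ha
      simp [hψ.glue_left_right h _ ha hb]
  · intro a _
    refine Finset.sum_eq_zero fun e _ => if_neg ?_
    rintro ⟨s, hs, hne⟩
    exact hne (by rw [glue_right h _ _ _ ⟨s, hs⟩]; rfl)

theorem crossConcurrence_groundComponent (hψ : SingleExcitation ψ) (h : Disjoint P Q) :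
    crossConcurrence 0 0 (groundComponent ψ P Q) = concurrence ψ P Q := by
  rw [crossConcurrence, hψ.leftWeight_groundComponent h, hψ.rightWeight_groundComponent h,
    concurrence]

theorem concurrence_mem_Icc (hψ : SingleExcitation ψ) (hunit : IsUnitVec ψ) (h : Disjoint P Q) :
    concurrence ψ P Q ∈ Set.Icc (0 : ℝ) 1 := by
  rw [← hψ.crossConcurrence_groundComponent h]
  refine crossConcurrence_mem_Icc _ _ ?_
  rw [← (hunit : ∑ f, ‖ψ f‖ ^ 2 = 1), ← hψ.sum_norm_sq_groundComponent h]
  exact le_add_of_nonneg_right (Finset.sum_nonneg fun _ _ => sq_nonneg _)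

theorem T_eq (hψ : SingleExcitation ψ) (hunit : IsUnitVec ψ) (him : (ψ 0).im = 0)
    (h : Disjoint P Q) {q : ℝ} (hq0 : q ≠ 0)
    (hq : ConvexOn ℝ (Set.Icc 0 1) (concurrenceT q)) :
    T q ψ P Q = concurrenceT q (concurrence ψ P Q) := by
  rw [T, hψ.reduced_eq h, mixedT_cross hq0 hq 0 0, hψ.crossConcurrence_groundComponent h]
  · exact fun a b ha hb => hψ.glue_left_right h 0 ha hb
  · rwa [groundComponent, glue_zero]
  · exact Finset.sum_nonneg fun _ _ => sq_nonneg _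
  · rw [hψ.sum_norm_sq_groundComponent h]
    exact hunit

end SingleExcitation

/-! ### Generalized `W`-class states -/

theorem wVec_apply_single {n d : ℕ} [NeZero d] (a : Fin n → Fin d → ℂ) (s : Fin n) {i : Fin d}
    (hi : i ≠ 0) : wVec a (Pi.single s i) = a s i := by
  have hinj : ∀ t j, j ≠ 0 → (Pi.single s i : Fin n → Fin d) = Pi.single t j → t = s ∧ j = i := by
    intro t j hj h
    have hs : t = s := by
      by_contra hne
      have := congrFun h t
      rw [Pi.single_eq_of_ne hne, Pi.single_eq_same] at this
      exact hj this.symm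
    subst hs
    exact ⟨rfl, (Pi.single_injective t h).symm⟩
  simp only [wVec, Finset.sum_apply, Pi.smul_apply, ket, smul_eq_mul]
  rw [Finset.sum_eq_single s, Finset.sum_eq_single i]
  · simp
  · intro j hj hji
    rw [Pi.single_eq_of_ne fun h => hji (hinj s j (by simpa using hj) h).2, mul_zero]
  · simp [hi]
  · intro t _ hts
    refine Finset.sum_eq_zero fun j hj => ?_
    rw [Pi.single_eq_of_ne fun h => hts (hinj t j (by simpa using hj) h).1, mul_zero]
  · simp

theorem wVec_apply_of_forall_ne {n d : ℕ} [NeZero d] (a : Fin n → Fin d → ℂ) {f : Fin n → Fin d}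
    (hf : ∀ s i, i ≠ 0 → f ≠ Pi.single s i) : wVec a f = 0 := by
  simp only [wVec, Finset.sum_apply, Pi.smul_apply, ket, smul_eq_mul]
  refine Finset.sum_eq_zero fun s _ => Finset.sum_eq_zero fun i hi => ?_
  rw [Pi.single_eq_of_ne (hf s i (by simpa using hi)), mul_zero]

theorem wVec_zero {n d : ℕ} [NeZero d] (a : Fin n → Fin d → ℂ) : wVec a 0 = 0 :=
  wVec_apply_of_forall_ne a fun s i hi h => hi (by simpa using (congrFun h s).symm)

theorem sum_norm_sq_wVec {n d : ℕ} [NeZero d] (a : Fin n → Fin d → ℂ) :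
    ∑ f, ‖wVec a f‖ ^ 2
      = ∑ s : Fin n, ∑ i ∈ Finset.univ.filter (fun i : Fin d => i ≠ 0), ‖a s i‖ ^ 2 := by
  rw [← Finset.sum_product']
  refine (Finset.sum_of_injOn (fun x : Fin n × Fin d => (Pi.single x.1 x.2 : Fin n → Fin d))
    ?_ (by simp) ?_ ?_).symm
  · rintro ⟨s, i⟩ hi ⟨t, j⟩ hj h
    simp only [Finset.coe_product, Set.mem_prod, Finset.mem_coe, Finset.mem_filter] at hi hj
    have hst : s = t := by
      by_contra hne
      have := congrFun h s
      simp only [Pi.single_eq_same, Pi.single_eq_of_ne hne] at this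
      exact hi.2.2 this
    subst hst
    exact congrArg (Prod.mk s) (Pi.single_injective s h)
  · intro f _ hf
    rw [wVec_apply_of_forall_ne a fun s i hi h => hf ⟨(s, i), by simp [hi], h.symm⟩]
    simp
  · rintro ⟨s, i⟩ hi
    rw [wVec_apply_single a s (by simpa using hi)]

theorem IsGWV.singleExcitation {n d : ℕ} [NeZero d] {ψ : (Fin n → Fin d) → ℂ} (h : IsGWV ψ) :
    SingleExcitation ψ := by
  obtain ⟨a, p, -, -, -, rfl⟩ := h
  intro f s t hst hs ht
  have h0 : f ≠ 0 := fun h => hs (congrFun h s)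
  have hf : ∀ u i, i ≠ 0 → f ≠ Pi.single u i := by
    rintro u i - rfl
    have hs : s = u := by
      by_contra hne
      exact hs (Pi.single_eq_of_ne hne _)
    have ht : t = u := by
      by_contra hne
      exact ht (Pi.single_eq_of_ne hne _)
    exact hst (hs.trans ht.symm)
  simp [wVec_apply_of_forall_ne a hf, ket, h0]

theorem IsGWV.im_apply_zero {n d : ℕ} [NeZero d] {ψ : (Fin n → Fin d) → ℂ} (h : IsGWV ψ) :
    (ψ 0).im = 0 := by
  obtain ⟨a, p, -, -, -, rfl⟩ := h
  simp [wVec_zero, ket]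

theorem IsGWV.isUnitVec {n d : ℕ} [NeZero d] {ψ : (Fin n → Fin d) → ℂ} (h : IsGWV ψ) :
    IsUnitVec ψ := by
  obtain ⟨a, p, hp0, hp1, ha, rfl⟩ := h
  have h1 : ∀ f, ‖((√p : ℂ) • wVec a + (√(1 - p) : ℂ) • ket 0 : (Fin n → Fin d) → ℂ) f‖ ^ 2
      = p * ‖wVec a f‖ ^ 2 + (1 - p) * ‖ket (d := d) (n := n) 0 f‖ ^ 2 := by
    intro f
    by_cases hf : f = 0
    · subst hf
      simp [wVec_zero, ket, Real.sq_sqrt (sub_nonneg.mpr hp1)]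
    · simp [ket, hf, mul_pow, Real.sq_sqrt hp0]
  have h2 : ∑ f, ‖ket (d := d) (n := n) 0 f‖ ^ 2 = 1 := by
    rw [Fintype.sum_eq_single 0 fun f hf => by simp [ket, hf]]
    simp [ket]
  unfold IsUnitVec
  rw [Finset.sum_congr rfl fun f _ => h1 f, Finset.sum_add_distrib, ← Finset.mul_sum,
    ← Finset.mul_sum, h2, sum_norm_sq_wVec, ha]
  ring

end GWV

theorem theorem1 {n d : ℕ} [NeZero d] (ψ : (Fin n → Fin d) → ℂ) (hψ : GWV.IsGWV ψ)
    {r : ℕ} (P : Finset (Fin n)) (Q : Fin r → Finset (Fin n))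
    (hP : P.Nonempty) (hQ : ∀ j, (Q j).Nonempty)
    (hPQ : ∀ j, Disjoint P (Q j)) (hQQ : ∀ i j, i ≠ j → Disjoint (Q i) (Q j))
    (q k β : ℝ) (hq : q ∈ Set.Icc ((5 - Real.sqrt 13) / 2) ((5 + Real.sqrt 13) / 2))
    (hk : 0 < k) (hk1 : k ≤ 1) (hβ : 2 ≤ β)
    (hT : ∀ i j : Fin r, (j : ℕ) = (i : ℕ) + 1 →
      GWV.T q ψ P (Q j) ^ 2 ≤ k * GWV.T q ψ P (Q i) ^ 2) :
    ∑ j : Fin r, GWV.K k β ^ GWV.hammingWeight (j : ℕ) * GWV.T q ψ P (Q j) ^ β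
      ≤ GWV.T q ψ P (Finset.univ.biUnion Q) ^ β := by
  have hq0 : 0 < q := by
    have : √13 < 5 := (Real.sqrt_lt' (by norm_num)).mpr (by norm_num)
    linarith [hq.1]
  have hconv := GWV.convexOn_concurrenceT hq
  have hs := hψ.singleExcitation
  have hTeq : ∀ R, Disjoint P R →
      GWV.T q ψ P R = GWV.concurrenceT q (GWV.concurrence ψ P R) := fun R hR =>
    hs.T_eq hψ.isUnitVec hψ.im_apply_zero hR hq0.ne' hconv
  have hT0 : ∀ R, Disjoint P R → 0 ≤ GWV.T q ψ P R := fun R hR => by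
    rw [hTeq R hR]
    exact GWV.concurrenceT_nonneg hq0 _
  have hU : Disjoint P (Finset.univ.biUnion Q) :=
    (Finset.disjoint_biUnion_right _ _ _).mpr fun j _ => hPQ j
  have hmono : ∑ j, GWV.T q ψ P (Q j) ^ 2 ≤ GWV.T q ψ P (Finset.univ.biUnion Q) ^ 2 := by
    simp only [hTeq _ (hPQ _), hTeq _ hU]
    have hc := hs.concurrence_mem_Icc hψ.isUnitVec hU
    exact GWV.sum_concurrenceT_sq_le _ hq0.ne' hconv (GWV.concurrenceT_nonneg hq0) _
      (fun j _ => (hs.concurrence_mem_Icc hψ.isUnitVec (hPQ j)).1) hc.1 hc.2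
      (GWV.sum_concurrence_sq ψ P hQQ)
  have hpow : ∀ t : ℝ, 0 ≤ t → t ^ β = (t ^ 2) ^ (β / 2) := fun t ht => by
    rw [← Real.rpow_natCast t 2, ← Real.rpow_mul ht]
    congr 1
    push_cast
    ring
  -- The squared entanglements, extended by zeros to a sequence.
  set x : ℕ → ℝ := fun j => if h : j < r then GWV.T q ψ P (Q ⟨j, h⟩) ^ 2 else 0 with hx
  have hx0 : ∀ j, 0 ≤ x j := fun j => by
    simp only [hx]
    split_ifs <;> positivity
  have hdec : ∀ j, x (j + 1) ≤ k * x j := fun j => by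
    by_cases h : j + 1 < r
    · simp only [hx, dif_pos h, dif_pos (j.lt_succ_self.trans h)]
      exact hT ⟨j, _⟩ ⟨j + 1, h⟩ rfl
    · simp only [hx, dif_neg h]
      exact mul_nonneg hk.le (hx0 j)
  have hext : ∀ g : ℕ → ℝ → ℝ, (∀ j, g j 0 = 0) →
      ∑ j : Fin r, g j (GWV.T q ψ P (Q j) ^ 2) = ∑ j ∈ Finset.range (2 ^ r), g j (x j) := by
    intro g hg
    rw [← Finset.sum_subset (Finset.range_mono Nat.lt_two_pow_self.le) fun j _ hj => by
      rw [Finset.mem_range] at hj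
      simp only [hx, dif_neg hj, hg], ← Fin.sum_univ_eq_sum_range (fun j => g j (x j))]
    exact Finset.sum_congr rfl fun j _ => by simp [hx]
  calc ∑ j : Fin r, GWV.K k β ^ GWV.hammingWeight (j : ℕ) * GWV.T q ψ P (Q j) ^ β
      = ∑ j ∈ Finset.range (2 ^ r), GWV.K k β ^ GWV.hammingWeight j * x j ^ (β / 2) := by
        rw [← hext (fun j y => GWV.K k β ^ GWV.hammingWeight j * y ^ (β / 2)) fun j => by
          rw [Real.zero_rpow (by linarith), mul_zero]]
        exact Finset.sum_congr rfl fun j _ => by rw [hpow _ (hT0 _ (hPQ j))]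
    _ ≤ (∑ j ∈ Finset.range (2 ^ r), x j) ^ (β / 2) :=
        GWV.sum_K_pow_hammingWeight_mul_rpow_le hk hk1 hβ r x hx0 hdec
    _ = (∑ j, GWV.T q ψ P (Q j) ^ 2) ^ (β / 2) := by rw [hext (fun _ y => y) fun _ => rfl]
    _ ≤ (GWV.T q ψ P (Finset.univ.biUnion Q) ^ 2) ^ (β / 2) :=
        Real.rpow_le_rpow (Finset.sum_nonneg fun _ _ => sq_nonneg _) hmono (by linarith)
    _ = GWV.T q ψ P (Finset.univ.biUnion Q) ^ β := (hpow _ (hT0 _ hU)).symm
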